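/- Let $d\ge 1$, let $S^{d-1}$ be the unit sphere of $\mathbf R^d$ with its normalized surface measure $d\omega$, and for $(\omega,p)\in S^{d-1}\times\mathbf R$ put $H_{\omega,p}=\{x\in\mathbf R^d : x\cdot\omega<p\}$; the closed halfspace $\overline{H_{\omega,p}}$ is contained in $\mathbf R^d\setminus\{0\}$ exactly when $p<0$. Let $\beta>0$ be a real number that is not an integer, and let $a(\omega,p)$ be a locally bounded real function on $S^{d-1}\times(-\infty,0)$ that is homogeneous of degree $-\beta$ in $p$: $a(\omega,rp)=r^{-\beta}a(\omega,p)$ for all $\omega\in S^{d-1}$, $p<0$, $r>0$. Then there is at most one non-negative Radon measure $\mu$ on $\mathbf R^d\setminus\{0\}$, with finite mass on every set whose closure in $\mathbf R^d$ does not contain the origin, such that $$\mu(H_{\omega,p})=a(\omega,p)\quad\text{for almost all }(\omega,p)\in S^{d-1}\times(-\infty,0)$$ (with respect to $d\omega\,dp$). Moreover, if such a measure $\mu$ exists, then: (i) $\mu$ is homogeneous of degree $-d-\beta$, that is, $\int\varphi(x/r)\,d\mu(x)=r^{-\beta}\int\varphi\,d\mu$ for all $r>0$ and all $C^\infty$ functions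 $\varphi$ with compact support in $\mathbf R^d\setminus\{0\}$; (ii) $R\mu=\partial_p a$ on $S^{d-1}\times(-\infty,0)$, where $R\mu$ is the Radon transform of $\mu$, defined by $\langle R\mu,\psi\rangle=\int R^*\psi\,d\mu$ with $R^*\psi(x)=\int_{S^{d-1}}\psi(\omega,x\cdot\omega)\,d\omega$; that is, $\partial_p a(\omega,p)$ exists for all $\omega\in S^{d-1}$ and $p<0$, and for every continuous function $\psi$ with compact support in $S^{d-1}\times(-\infty,0)$ (extended by zero to $S^{d-1}\times\mathbf R$) the following integrals converge absolutely and $$\int_{\mathbf R^d\setminus\{0\}}\int_{S^{d-1}}\psi(\omega,x\cdot\omega)\,d\omega\,d\mu(x)=\int_{S^{d-1}}\int_{-\infty}^0\partial_p a(\omega,p)\,\psi(\omega,p)\,dp\,d\omega .$$ -/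

import Mathlib

open MeasureTheory
open scoped CompactlySupported

noncomputable section

namespace CramerWold

/-- The space `ℝ^d`, with its Euclidean norm and inner product. -/
abbrev Space (d : ℕ) : Type := EuclideanSpace ℝ (Fin d)

/-- The punctured space `ℝ^d ∖ {0}`. -/
abbrev Punctured (d : ℕ) : Type := {x : Space d // x ≠ 0}

/-- The unit sphere `S^{d-1}` of `ℝ^d`. -/
abbrev UnitSphere (d : ℕ) : Type := Metric.sphere (0 : Space d) 1

/-- The normalized surface measure `dω` on `S^{d-1}`. -/
def sphereMeasure (d : ℕ) : Measure (UnitSphere d) :=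
  ((volume : Measure (Space d)).toSphere Set.univ)⁻¹ • (volume : Measure (Space d)).toSphere

/-- The measure `dp dω` on `S^{d-1} × {p < 0}`, seen as a measure on `S^{d-1} × ℝ`. -/
def negMeasure (d : ℕ) : Measure (UnitSphere d × ℝ) :=
  (sphereMeasure d).prod (volume.restrict (Set.Iio 0))

/-- The halfspace `H_{ω,p} = {x | x · ω < p}`, without the origin. For `p < 0`, the only case
in which it is used, the origin does not belong to the closure of `{x ∈ ℝ^d | x · ω < p}`. -/
def halfspace {d : ℕ} (ω : UnitSphere d) (p : ℝ) : Set (Punctured d) :=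
  {x | inner ℝ (x : Space d) (ω : Space d) < p}

/-- `a` is locally bounded on `S^{d-1} × {p < 0}`. -/
def LocallyBoundedNeg {d : ℕ} (a : UnitSphere d → ℝ → ℝ) : Prop :=
  ∀ (ω : UnitSphere d) (p : ℝ), p < 0 →
    ∃ C : ℝ, ∀ᶠ z : UnitSphere d × ℝ in nhds (ω, p), |a z.1 z.2| ≤ C

/-- `a` is homogeneous of degree `γ` in the variable `p < 0`, for every `ω`. -/
def HomogeneousInP {d : ℕ} (a : UnitSphere d → ℝ → ℝ) (γ : ℝ) : Prop :=
  ∀ (ω : UnitSphere d) (p r : ℝ), p < 0 → 0 < r → a ω (r * p) = r ^ γ * a ω p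

/-- The non-negative measure `μ` on `ℝ^d ∖ {0}` is a Radon measure, it has finite mass on sets
bounded away from the origin, and `μ (H_{ω,p}) = a (ω, p)` for almost all `(ω, p)` with
`p < 0`. -/
structure Represents {d : ℕ} (μ : Measure (Punctured d)) (a : UnitSphere d → ℝ → ℝ) : Prop where
  radon : IsFiniteMeasureOnCompacts μ
  finite_away : ∀ A : Set (Punctured d),
    (0 : Space d) ∉ closure ((fun x : Punctured d => (x : Space d)) '' A) → μ A < ⊤
  halfspace_eq : ∀ᵐ z ∂(negMeasure d), μ.real (halfspace z.1 z.2) = a z.1 z.2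

/-- The measure `μ` on `ℝ^d ∖ {0}` is homogeneous of degree `α`:
`⟨μ, φ(·/r)⟩ = r^(d+α) ⟨μ, φ⟩` for all `r > 0` and all smooth `φ` with compact support
in `ℝ^d ∖ {0}`. -/
def HomogeneousMeasure {d : ℕ} (μ : Measure (Punctured d)) (α : ℝ) : Prop :=
  ∀ φ : Space d → ℝ, ContDiff ℝ (⊤ : ℕ∞) φ → HasCompactSupport φ → (0 : Space d) ∉ tsupport φ →
    ∀ r : ℝ, 0 < r →
      ∫ x, φ (r⁻¹ • (x : Space d)) ∂μ = r ^ ((d : ℝ) + α) * ∫ x, φ (x : Space d) ∂μ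

/-- The test functions on `S^{d-1} × {p < 0}`: continuous functions with compact support. -/
abbrev NegTest (d : ℕ) : Type := C_c(UnitSphere d × Set.Iio (0 : ℝ), ℝ)

/-- A test function on `S^{d-1} × {p < 0}`, extended by zero to `S^{d-1} × ℝ`. -/
def extendZero {d : ℕ} (ψ : NegTest d) (ω : UnitSphere d) (p : ℝ) : ℝ :=
  if h : p < 0 then ψ (ω, ⟨p, h⟩) else 0

/-- The dual Radon transform `R^*ψ (x) = ∫ ψ (ω, x · ω) dω`. -/
def dualRadon {d : ℕ} (ψ : NegTest d) (x : Punctured d) : ℝ :=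
  ∫ ω, extendZero ψ ω (inner ℝ (x : Space d) (ω : Space d)) ∂(sphereMeasure d)

/-- The Radon transform of `μ` on `S^{d-1} × {p < 0}`, as a linear form on test functions:
`⟨Rμ, ψ⟩ = ⟨μ, R^*ψ⟩`. -/
def radonTransform {d : ℕ} (μ : Measure (Punctured d)) (ψ : NegTest d) : ℝ :=
  ∫ x, dualRadon ψ x ∂μ

/-- `Rμ = ∂_p a` on `S^{d-1} × {p < 0}`: the derivative `∂_p a` exists there, `Rμ` is defined
on every test function, and `Rμ` is the measure with the density `∂_p a`. -/
def RadonEqDerivP {d : ℕ} (μ : Measure (Punctured d)) (a : UnitSphere d → ℝ → ℝ) : Prop :=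
  (∀ (ω : UnitSphere d) (p : ℝ), p < 0 → DifferentiableAt ℝ (a ω) p) ∧
  ∀ ψ : NegTest d,
    Integrable (dualRadon ψ) μ ∧
    Integrable (fun z : UnitSphere d × ℝ => deriv (a z.1) z.2 * extendZero ψ z.1 z.2)
      (negMeasure d) ∧
    radonTransform μ ψ = ∫ z, deriv (a z.1) z.2 * extendZero ψ z.1 z.2 ∂(negMeasure d)

end CramerWold

end

open CramerWold

/-!
In the direction `ω` only the tails `μ {x | x · ω < p}` with `p < 0` are given, and by homogeneity
they say that on the negative half-line the marginal of `μ` is a multiple of the measure with tails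
`(-p) ^ (-β)`. The mass of `μ` near the origin may be infinite, so `μ` has no Fourier transform;
but for `m = ⌊β⌋`, as `m < β < m + 1`, the remainder `exp (i x · ξ) - ∑_{k ≤ m} (i x · ξ) ^ k / k!`
is `μ`-integrable, and its integral is determined by the marginals. A difference of order
`2 * (m + 1)` in `ξ`, with step `η`, kills the Taylor polynomial and leaves the characteristic
function of the finite measure `|exp (i x · η) - 1| ^ (2 * (m + 1)) dμ(x)`; the weights for various
`η` have no common zero outside the origin, so `μ` is determined.

The image of `μ` under a dilation, suitably normalized, has the same halfspace masses, so it is `μ`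
by uniqueness. Finally, the image of `dω dμ` under `(ω, x) ↦ (ω, x · ω)` has on `p < 0` the density
`μ (H_{ω,-1}) β (-p) ^ (-β - 1) = ∂_p a`, which is the formula for the Radon transform.
-/

noncomputable section

open Set Filter Topology
open scoped ENNReal

namespace CramerWold

section LineMeasures

lemma restrict_Iio_congr {α : Type*} [TopologicalSpace α] [LinearOrder α] [OrderTopology α]
    [SecondCountableTopology α] [DenselyOrdered α] [NoMinOrder α] [MeasurableSpace α]
    [BorelSpace α] {ρ τ : Measure α} {a : α} (hfin : ∀ p < a, ρ (Iio p) ≠ ⊤)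
    (h : ∀ p < a, ρ (Iio p) = τ (Iio p)) : ρ.restrict (Iio a) = τ.restrict (Iio a) := by
  obtain ⟨u, hu_mono, hu_lt, hu_tendsto⟩ := exists_seq_strictMono_tendsto a
  rw [← (isLUB_of_tendsto_atTop hu_mono.monotone hu_tendsto).iUnion_Iio_eq,
    Measure.restrict_iUnion_congr]
  intro n
  have : IsFiniteMeasure (ρ.restrict (Iio (u n))) := ⟨by simpa using (hfin _ (hu_lt n)).lt_top⟩
  refine ext_of_generate_finite (range Iio)
    (BorelSpace.measurable_eq.trans (borel_eq_generateFrom_Iio α)) isPiSystem_Iio ?_ ?_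
  · rintro _ ⟨p, rfl⟩
    rw [Measure.restrict_apply measurableSet_Iio, Measure.restrict_apply measurableSet_Iio,
      Iio_inter_Iio]
    exact h _ (min_lt_of_right_lt (hu_lt n))
  · simpa using h _ (hu_lt n)

/-- The measure on the negative half-line with `powerTail β (-∞, p) = (-p) ^ (-β)`, up to a
factor the marginal of a homogeneous measure. -/
def powerTail (β : ℝ) : Measure ℝ :=
  (volume.restrict (Iio 0)).withDensity fun p ↦ ENNReal.ofReal (β * (-p) ^ (-β - 1))

instance (β : ℝ) : SigmaFinite (powerTail β) := SigmaFinite.withDensity_ofReal _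

lemma powerTail_Iio {β p : ℝ} (hβ : 0 < β) (hp : p < 0) :
    powerTail β (Iio p) = ENNReal.ofReal ((-p) ^ (-β)) := by
  have hint : IntegrableOn (fun t : ℝ ↦ β * (-t) ^ (-β - 1)) (Iio p) :=
    IntegrableOn.comp_neg_Iio (f := fun t ↦ β * t ^ (-β - 1))
      ((integrableOn_Ioi_rpow_of_lt (by linarith) (neg_pos.2 hp)).const_mul β)
  rw [powerTail, withDensity_apply _ measurableSet_Iio,
    Measure.restrict_restrict measurableSet_Iio, inter_eq_left.2 (Iio_subset_Iio hp.le),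
    ← ofReal_integral_eq_lintegral_ofReal hint]
  · rw [← integral_Iic_eq_integral_Iio, integral_comp_neg_Iic (f := fun t ↦ β * t ^ (-β - 1)),
      integral_const_mul, integral_Ioi_rpow_of_lt (by linarith) (neg_pos.2 hp), sub_add_cancel]
    congr 1
    field_simp
  · filter_upwards [ae_restrict_mem measurableSet_Iio] with t ht
    have : 0 < -t := neg_pos.2 (lt_trans ht hp)
    simp only [Pi.zero_apply]
    positivity

lemma powerTail_restrict_Iio (β : ℝ) : (powerTail β).restrict (Iio 0) = powerTail β := by
  rw [powerTail, restrict_withDensity measurableSet_Iio,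
    Measure.restrict_restrict measurableSet_Iio, inter_self]

lemma restrict_Iio_eq_smul_powerTail {ρ : Measure ℝ} {β : ℝ} {c : ℝ≥0∞} (hβ : 0 < β) (hc : c ≠ ⊤)
    (h : ∀ p < 0, ρ (Iio p) = c * ENNReal.ofReal ((-p) ^ (-β))) :
    ρ.restrict (Iio 0) = c • powerTail β := by
  rw [restrict_Iio_congr (τ := c • powerTail β), Measure.restrict_smul, powerTail_restrict_Iio]
  · intro p hp
    rw [h p hp]
    exact ENNReal.mul_ne_top hc ENNReal.ofReal_ne_top
  · intro p hp
    rw [h p hp, Measure.smul_apply, powerTail_Iio hβ hp, smul_eq_mul]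

/-- The bound satisfied, up to a constant, by a function with a zero of order `m + 1` at the
origin and growth of order `m` at infinity. -/
def taylorGauge (m : ℕ) (t : ℝ) : ℝ := min (|t| ^ m) (|t| ^ (m + 1))

lemma taylorGauge_nonneg (m : ℕ) (t : ℝ) : 0 ≤ taylorGauge m t := by
  unfold taylorGauge; positivity

lemma continuous_taylorGauge (m : ℕ) : Continuous (taylorGauge m) := by
  unfold taylorGauge; fun_prop

lemma taylorGauge_zero (m : ℕ) : taylorGauge m 0 = 0 := by
  simp [taylorGauge]

lemma taylorGauge_neg (m : ℕ) (t : ℝ) : taylorGauge m (-t) = taylorGauge m t := by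
  simp only [taylorGauge, abs_neg]

lemma rpow_mul_taylorGauge_le {m k : ℕ} {t : ℝ} (s : ℝ) (ht : 0 < t)
    (hk : taylorGauge m t ≤ |t| ^ k) : ‖t ^ s * taylorGauge m t‖ ≤ t ^ (k + s) := by
  rw [Real.norm_of_nonneg (mul_nonneg (by positivity) (taylorGauge_nonneg m t))]
  calc t ^ s * taylorGauge m t ≤ t ^ s * |t| ^ k := by gcongr
    _ = t ^ (k + s) := by
      rw [abs_of_pos ht, ← Real.rpow_natCast, ← Real.rpow_add ht, add_comm]

lemma integrableOn_rpow_mul_taylorGauge {m : ℕ} {s : ℝ} (h₁ : m + s < -1)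
    (h₂ : -1 < (m + 1 : ℕ) + s) : IntegrableOn (fun t ↦ t ^ s * taylorGauge m t) (Ioi 0) := by
  have hmeas : AEStronglyMeasurable (fun t ↦ t ^ s * taylorGauge m t) :=
    (Measurable.mul (by fun_prop) (continuous_taylorGauge m).measurable).aestronglyMeasurable
  have hnear : IntegrableOn (fun t ↦ t ^ s * taylorGauge m t) (Ioo 0 1) := by
    refine Integrable.mono' ((intervalIntegral.integrableOn_Ioo_rpow_iff one_pos).2 h₂)
      hmeas.restrict ?_
    filter_upwards [ae_restrict_mem measurableSet_Ioo] with t ht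
    exact rpow_mul_taylorGauge_le s ht.1 (min_le_right _ _)
  have hfar : IntegrableOn (fun t ↦ t ^ s * taylorGauge m t) (Ioi 1) := by
    refine Integrable.mono' (integrableOn_Ioi_rpow_of_lt h₁ one_pos) hmeas.restrict ?_
    filter_upwards [ae_restrict_mem measurableSet_Ioi] with t ht
    exact rpow_mul_taylorGauge_le s (one_pos.trans ht) (min_le_left _ _)
  rw [← Ioo_union_Ici_eq_Ioi (zero_lt_one' ℝ)]
  exact hnear.union ((integrableOn_Ici_iff_integrableOn_Ioi).2 hfar)

lemma integrable_taylorGauge_powerTail {m : ℕ} {β : ℝ} (h₁ : m < β) (h₂ : β < m + 1) :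
    Integrable (taylorGauge m) (powerTail β) := by
  have hβ : 0 < β := (Nat.cast_nonneg m).trans_lt h₁
  have hpos : IntegrableOn (fun t ↦ t ^ (-β - 1) * taylorGauge m t) (Ioi (-0)) := by
    rw [neg_zero]
    exact integrableOn_rpow_mul_taylorGauge (by linarith) (by push_cast; linarith)
  rw [powerTail, integrable_withDensity_iff_integrable_smul' (by fun_prop) (by simp)]
  refine (hpos.comp_neg_Iio.const_mul β).congr ?_
  filter_upwards [ae_restrict_mem measurableSet_Iio] with t ht
  have : 0 < -t := neg_pos.2 ht
  rw [ENNReal.toReal_ofReal (by positivity), taylorGauge_neg, smul_eq_mul, mul_assoc]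

end LineMeasures

section ExponentialRemainder

open Polynomial
open scoped fwdDiff

lemma fwdDiff_iter_eval_eq_zero {R : Type*} [CommRing R] {P : R[X]} {n : ℕ}
    (hP : P.natDegree < n) (h : R) : (Δ_[h])^[n] P.eval = 0 := by
  funext x
  let Q := P.comp (C x + C h * X)
  have hQ : Q.natDegree < n := by
    have hlin : (C x + C h * X).natDegree ≤ 1 := by compute_degree
    calc Q.natDegree ≤ P.natDegree * 1 := natDegree_comp_le.trans (Nat.mul_le_mul_left _ hlin)
      _ < n := by rwa [mul_one]
  have hstep : (Δ_[h])^[n] P.eval x = (Δ_[1])^[n] Q.eval 0 := by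
    simp [fwdDiff_iter_eq_sum_shift, Q, mul_comm h]
  rw [hstep, fwdDiff_iter_eq_zero_of_degree_lt hQ, Pi.zero_apply, Pi.zero_apply]

/-- The sum of the first `n` terms of the power series of `z ↦ exp (I * z)`. -/
def expTaylor (n : ℕ) : ℂ[X] :=
  ∑ k ∈ Finset.range n, C (Complex.I ^ k / k.factorial) * X ^ k

lemma expTaylor_succ (n : ℕ) :
    expTaylor (n + 1) = expTaylor n + C (Complex.I ^ n / n.factorial) * X ^ n :=
  Finset.sum_range_succ _ n

lemma derivative_expTaylor_succ (n : ℕ) :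
    derivative (expTaylor (n + 1)) = C Complex.I * expTaylor n := by
  rw [expTaylor, expTaylor, Finset.sum_range_succ', derivative_add, derivative_sum,
    Finset.mul_sum]
  simp only [pow_zero, derivative_C_mul, derivative_one, mul_zero, add_zero]
  refine Finset.sum_congr rfl fun k _ ↦ ?_
  have hfac : ((k + 1).factorial : ℂ) = (k + 1) * k.factorial := by
    rw [Nat.factorial_succ]; push_cast; ring
  have hk : (k + 1 : ℂ) ≠ 0 := by exact_mod_cast k.succ_ne_zero
  have hcoeff : Complex.I ^ (k + 1) / (k + 1).factorial * ((k + 1 : ℕ) : ℂ)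
      = Complex.I * (Complex.I ^ k / k.factorial) := by
    rw [hfac]; push_cast; field_simp; ring
  rw [derivative_X_pow, ← mul_assoc, ← C_mul, hcoeff, C_mul, mul_assoc, Nat.add_sub_cancel]

lemma natDegree_expTaylor_succ_le (n : ℕ) : (expTaylor (n + 1)).natDegree ≤ n :=
  natDegree_sum_le_of_forall_le _ _ fun _ hk ↦
    (natDegree_C_mul_X_pow_le _ _).trans (Finset.mem_range_succ_iff.1 hk)

/-- The remainder of the power series of `z ↦ exp (I * z)` after its first `n` terms. -/
def expRem (n : ℕ) (z : ℂ) : ℂ := Complex.exp (Complex.I * z) - (expTaylor n).eval z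

lemma continuous_expRem (n : ℕ) : Continuous (expRem n) := by
  unfold expRem; fun_prop

lemma expRem_succ (n : ℕ) (z : ℂ) :
    expRem (n + 1) z = expRem n z - Complex.I ^ n / n.factorial * z ^ n := by
  simp only [expRem, expTaylor_succ, eval_add, eval_mul, eval_C, eval_pow, eval_X]
  ring

lemma expRem_succ_zero (n : ℕ) : expRem (n + 1) 0 = 0 := by
  simp [expRem, expTaylor, eval_finsetSum, Finset.sum_range_succ']

lemma hasDerivAt_expRem_succ (n : ℕ) (z : ℂ) :
    HasDerivAt (expRem (n + 1)) (Complex.I * expRem n z) z := by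
  have hexp : HasDerivAt (fun z ↦ Complex.exp (Complex.I * z))
      (Complex.exp (Complex.I * z) * Complex.I) z := by
    simpa using ((hasDerivAt_id z).const_mul Complex.I).cexp
  convert! hexp.sub ((expTaylor (n + 1)).hasDerivAt z) using 1
  rw [derivative_expTaylor_succ, eval_mul, eval_C, expRem]
  ring

lemma norm_expRem_le (n : ℕ) (t : ℝ) : ‖expRem n t‖ ≤ |t| ^ n := by
  induction n generalizing t with
  | zero => simp [expRem, expTaylor, Complex.norm_exp_I_mul_ofReal]
  | succ n ih =>
    have hderiv (s : ℝ) : HasDerivWithinAt (fun s : ℝ ↦ expRem (n + 1) s)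
        (Complex.I * expRem n s) (Metric.closedBall 0 |t|) s :=
      (hasDerivAt_expRem_succ n s).comp_ofReal.hasDerivWithinAt
    have hbound : ∀ s ∈ Metric.closedBall (0 : ℝ) |t|, ‖Complex.I * expRem n s‖ ≤ |t| ^ n := by
      intro s hs
      rw [norm_mul, Complex.norm_I, one_mul]
      exact (ih s).trans (pow_le_pow_left₀ (abs_nonneg s) (by simpa using hs) n)
    have := (convex_closedBall (0 : ℝ) |t|).norm_image_sub_le_of_norm_hasDerivWithin_le
      (fun s _ ↦ hderiv s) hbound (x := 0) (y := t) (by simp) (by simp)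
    simpa [expRem_succ_zero, pow_succ] using this

lemma norm_expRem_succ_le_taylorGauge (m : ℕ) (t : ℝ) :
    ‖expRem (m + 1) t‖ ≤ 2 * taylorGauge m t := by
  have hterm : ‖Complex.I ^ m / m.factorial * (t : ℂ) ^ m‖ ≤ |t| ^ m := by
    rw [norm_mul, norm_div, norm_pow, norm_pow, Complex.norm_I, one_pow, Complex.norm_natCast,
      Complex.norm_real, Real.norm_eq_abs]
    refine mul_le_of_le_one_left (by positivity) (div_le_self zero_le_one ?_)
    exact_mod_cast m.factorial_pos
  rw [taylorGauge, mul_min_of_nonneg _ _ zero_le_two]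
  refine le_min ?_ ((norm_expRem_le (m + 1) t).trans
    (le_mul_of_one_le_left (by positivity) one_le_two))
  rw [expRem_succ, two_mul]
  exact (norm_sub_le _ _).trans (add_le_add (norm_expRem_le m t) hterm)

lemma fwdDiff_iter_expRem_succ {m n : ℕ} (hmn : m < n) (z h : ℂ) :
    (Δ_[h])^[n] (expRem (m + 1)) z
      = Complex.exp (Complex.I * z) * (Complex.exp (Complex.I * h) - 1) ^ n := by
  let e : AddChar ℂ ℂ :=
    { toFun := fun z ↦ Complex.exp (Complex.I * z)
      map_zero_eq_one' := by simp
      map_add_eq_mul' := fun z w ↦ by rw [mul_add, Complex.exp_add] }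
  have hsplit : expRem (m + 1) = ⇑e + (-1 : ℂ) • (expTaylor (m + 1)).eval := by
    funext z
    simp [expRem, e, sub_eq_add_neg]
  rw [hsplit, fwdDiff_iter_add, fwdDiff_iter_const_smul,
    fwdDiff_iter_eval_eq_zero ((natDegree_expTaylor_succ_le m).trans_lt hmn), smul_zero, add_zero,
    fwdDiff_addChar_eq, mul_comm]
  rfl

/-- The weight `|exp (I * t) - 1| ^ (2 * n)`, which vanishes to order `2 * n` at the origin. -/
def expWeight (n : ℕ) (t : ℝ) : ℝ := (2 - 2 * Real.cos t) ^ n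

lemma continuous_expWeight (n : ℕ) : Continuous (expWeight n) := by
  unfold expWeight; fun_prop

lemma expWeight_nonneg (n : ℕ) (t : ℝ) : 0 ≤ expWeight n t :=
  pow_nonneg (by linarith [Real.cos_le_one t]) n

lemma expWeight_one_pos (n : ℕ) : 0 < expWeight n 1 := by
  have hcos : Real.cos 1 < Real.cos 0 :=
    Real.cos_lt_cos_of_nonneg_of_le_pi le_rfl (by linarith [Real.pi_gt_three]) one_pos
  exact pow_pos (by linarith [Real.cos_zero]) n

lemma ofReal_expWeight (n : ℕ) (t : ℝ) :
    (expWeight n t : ℂ) = (-1) ^ n * (Complex.exp (Complex.I * (-n * t))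
      * (Complex.exp (Complex.I * t) - 1) ^ (2 * n)) := by
  have hcos : ((2 - 2 * Real.cos t : ℝ) : ℂ)
      = -1 * (Complex.exp (-(Complex.I * t)) * (Complex.exp (Complex.I * t) - 1) ^ 2) := by
    have h := Complex.exp_neg (Complex.I * t)
    have hne := Complex.exp_ne_zero (Complex.I * t)
    push_cast
    rw [Complex.two_cos, neg_mul, mul_comm (t : ℂ), h]
    field_simp
    ring
  rw [expWeight, Complex.ofReal_pow, hcos, mul_pow, mul_pow, ← pow_mul, ← Complex.exp_nat_mul]
  ring_nf

lemma exp_mul_expWeight (m : ℕ) (a b : ℝ) :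
    Complex.exp (Complex.I * a) * expWeight (m + 1) b
      = ∑ k ∈ Finset.range (2 * (m + 1) + 1),
          ((-1) ^ (m + 1) * ((-1) ^ (2 * (m + 1) - k) * (2 * (m + 1)).choose k)) *
            expRem (m + 1) (a + (k - (m + 1)) * b : ℝ) := by
  have hdiff := fwdDiff_iter_expRem_succ (show m < 2 * (m + 1) by lia) (a - (m + 1) * b) b
  have hexp : Complex.exp (Complex.I * (a - (m + 1) * b))
      = Complex.exp (Complex.I * a) * Complex.exp (Complex.I * (-(m + 1 : ℕ) * b)) := by
    rw [← Complex.exp_add]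
    push_cast
    ring_nf
  rw [fwdDiff_iter_eq_sum_shift, hexp, mul_assoc] at hdiff
  rw [ofReal_expWeight, mul_left_comm, ← hdiff, Finset.mul_sum]
  refine Finset.sum_congr rfl fun k _ ↦ ?_
  rw [zsmul_eq_mul, nsmul_eq_mul, ← mul_assoc]
  push_cast
  ring_nf

end ExponentialRemainder

section Marginals

variable {E : Type*} [NormedAddCommGroup E] [InnerProductSpace ℝ E] [MeasurableSpace E]
  [BorelSpace E]

/-- The image of a measure under the projection `x ↦ x · ξ`. -/
def marginal (μ : Measure E) (ξ : E) : Measure ℝ := μ.map fun x ↦ inner ℝ x ξ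

variable {μ ν : Measure E} {m : ℕ}

lemma marginal_neg (μ : Measure E) (ξ : E) : marginal μ (-ξ) = (marginal μ ξ).map Neg.neg := by
  rw [marginal, marginal, Measure.map_map measurable_neg (by fun_prop)]
  simp only [Function.comp_def, inner_neg_right]

lemma marginal_restrict_Ioi (μ : Measure E) (ξ : E) :
    (marginal μ ξ).restrict (Ioi 0) = ((marginal μ (-ξ)).restrict (Iio 0)).map Neg.neg := by
  nth_rewrite 1 [← neg_neg ξ]
  rw [marginal_neg μ (-ξ), Measure.restrict_map measurable_neg measurableSet_Ioi]
  simp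

lemma marginal_restrict_compl_zero_congr
    (h : ∀ ξ, (marginal μ ξ).restrict (Iio 0) = (marginal ν ξ).restrict (Iio 0)) (ξ : E) :
    (marginal μ ξ).restrict {0}ᶜ = (marginal ν ξ).restrict {0}ᶜ := by
  rw [← Iio_union_Ioi, Measure.restrict_union_congr]
  exact ⟨h ξ, by rw [marginal_restrict_Ioi, marginal_restrict_Ioi, h]⟩

lemma integrable_taylorGauge_marginal
    (h : ∀ ξ, IntegrableOn (taylorGauge m) (Iio 0) (marginal μ ξ)) (ξ : E) :
    Integrable (taylorGauge m) (marginal μ ξ) := by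
  have hpos : IntegrableOn (taylorGauge m) (Ioi 0) (marginal μ ξ) := by
    rw [IntegrableOn, marginal_restrict_Ioi, integrable_map_measure
      (continuous_taylorGauge m).aestronglyMeasurable (by fun_prop)]
    simp only [Function.comp_def, taylorGauge_neg]
    exact h (-ξ)
  refine (integrableOn_iff_integrable_of_support_subset fun t ht ↦ ?_).1 ((h ξ).union hpos)
  rw [Iio_union_Ioi]
  rintro rfl
  exact ht (taylorGauge_zero m)

lemma integral_inner_congr {F : Type*} [NormedAddCommGroup F] [NormedSpace ℝ F] {ξ : E}
    (h : (marginal μ ξ).restrict {0}ᶜ = (marginal ν ξ).restrict {0}ᶜ) {f : ℝ → F}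
    (hf : StronglyMeasurable f) (hf₀ : f 0 = 0) :
    ∫ x, f (inner ℝ x ξ) ∂μ = ∫ x, f (inner ℝ x ξ) ∂ν := by
  have hrestrict (ρ : Measure E) :
      ∫ x, f (inner ℝ x ξ) ∂ρ = ∫ t in {0}ᶜ, f t ∂(marginal ρ ξ) := by
    rw [setIntegral_eq_integral_of_forall_compl_eq_zero (by simp [hf₀]), marginal,
      integral_map (by fun_prop) hf.aestronglyMeasurable]
  rw [hrestrict, hrestrict, h]

lemma integrable_expRem_inner {ξ : E} (h : Integrable (taylorGauge m) (marginal μ ξ)) :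
    Integrable (fun x ↦ expRem (m + 1) (inner ℝ x ξ : ℝ)) μ := by
  have hcont : Continuous fun t : ℝ ↦ expRem (m + 1) t :=
    (continuous_expRem _).comp Complex.continuous_ofReal
  exact (integrable_map_measure hcont.aestronglyMeasurable (by fun_prop)).1
    ((h.const_mul 2).mono' hcont.aestronglyMeasurable
      (ae_of_all _ (norm_expRem_succ_le_taylorGauge m)))

omit [MeasurableSpace E] [BorelSpace E] in
lemma exp_inner_mul_expWeight_inner (m : ℕ) (ξ η x : E) :
    Complex.exp (Complex.I * (inner ℝ x ξ : ℝ)) * expWeight (m + 1) (inner ℝ x η)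
      = ∑ k ∈ Finset.range (2 * (m + 1) + 1),
          ((-1) ^ (m + 1) * ((-1) ^ (2 * (m + 1) - k) * (2 * (m + 1)).choose k)) *
            expRem (m + 1) (inner ℝ x (ξ + ((k : ℝ) - (m + 1)) • η) : ℝ) := by
  simp only [exp_mul_expWeight, inner_add_right, real_inner_smul_right]

lemma integrable_exp_inner_mul_expWeight_inner
    (h : ∀ ξ, Integrable (taylorGauge m) (marginal μ ξ)) (ξ η : E) :
    Integrable (fun x ↦ Complex.exp (Complex.I * (inner ℝ x ξ : ℝ))
      * expWeight (m + 1) (inner ℝ x η)) μ := by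
  simp only [exp_inner_mul_expWeight_inner]
  exact integrable_finsetSum _ fun k _ ↦ (integrable_expRem_inner (h _)).const_mul _

lemma integral_exp_inner_mul_expWeight_inner_congr
    (hμ : ∀ ξ, Integrable (taylorGauge m) (marginal μ ξ))
    (hν : ∀ ξ, Integrable (taylorGauge m) (marginal ν ξ))
    (h : ∀ ξ, (marginal μ ξ).restrict {0}ᶜ = (marginal ν ξ).restrict {0}ᶜ) (ξ η : E) :
    ∫ x, Complex.exp (Complex.I * (inner ℝ x ξ : ℝ)) * expWeight (m + 1) (inner ℝ x η) ∂μ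
      = ∫ x, Complex.exp (Complex.I * (inner ℝ x ξ : ℝ)) * expWeight (m + 1) (inner ℝ x η) ∂ν := by
  simp only [exp_inner_mul_expWeight_inner]
  rw [integral_finsetSum _ fun k _ ↦ (integrable_expRem_inner (hμ _)).const_mul _,
    integral_finsetSum _ fun k _ ↦ (integrable_expRem_inner (hν _)).const_mul _]
  refine Finset.sum_congr rfl fun k _ ↦ ?_
  rw [integral_const_mul, integral_const_mul]
  congr 1
  exact integral_inner_congr (h _) (f := fun t ↦ expRem (m + 1) t)
    ((continuous_expRem _).comp Complex.continuous_ofReal).stronglyMeasurable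
    (by simpa using expRem_succ_zero m)

/-- The measure `|exp (I * x · η) - 1| ^ (2 * n) dμ(x)`. The weight makes it finite for large `n`
while keeping `μ` visible wherever `x · η` is not a multiple of `2 * π`. -/
def weighted (μ : Measure E) (n : ℕ) (η : E) : Measure E :=
  μ.withDensity fun x ↦ ENNReal.ofReal (expWeight n (inner ℝ x η))

lemma measurable_expWeight_inner (n : ℕ) (η : E) :
    Measurable fun x ↦ ENNReal.ofReal (expWeight n (inner ℝ x η)) :=
  ((continuous_expWeight n).comp (by fun_prop)).measurable.ennreal_ofReal

lemma isFiniteMeasure_weighted (h : ∀ ξ, Integrable (taylorGauge m) (marginal μ ξ)) (η : E) :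
    IsFiniteMeasure (weighted μ (m + 1) η) := by
  have hint := (integrable_exp_inner_mul_expWeight_inner h 0 η).re
  simp only [inner_zero_right, Complex.ofReal_zero, mul_zero, Complex.exp_zero, one_mul] at hint
  exact isFiniteMeasure_withDensity_ofReal hint.2

lemma charFun_weighted (μ : Measure E) (n : ℕ) (η ξ : E) : charFun (weighted μ n η) ξ
    = ∫ x, Complex.exp (Complex.I * (inner ℝ x ξ : ℝ)) * expWeight n (inner ℝ x η) ∂μ := by
  rw [charFun_apply, weighted, integral_withDensity_eq_integral_toReal_smul
    (measurable_expWeight_inner n η) (ae_of_all _ fun _ ↦ ENNReal.ofReal_lt_top)]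
  refine integral_congr_ae (ae_of_all _ fun x ↦ ?_)
  simp only [ENNReal.toReal_ofReal (expWeight_nonneg n _), Complex.real_smul, mul_comm]

lemma weighted_congr [CompleteSpace E] [SecondCountableTopology E]
    (hμ : ∀ ξ, Integrable (taylorGauge m) (marginal μ ξ))
    (hν : ∀ ξ, Integrable (taylorGauge m) (marginal ν ξ))
    (h : ∀ ξ, (marginal μ ξ).restrict {0}ᶜ = (marginal ν ξ).restrict {0}ᶜ) (η : E) :
    weighted μ (m + 1) η = weighted ν (m + 1) η := by
  have := isFiniteMeasure_weighted hμ η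
  have := isFiniteMeasure_weighted hν η
  refine Measure.ext_of_charFun (funext fun ξ ↦ ?_)
  rw [charFun_weighted, charFun_weighted,
    integral_exp_inner_mul_expWeight_inner_congr hμ hν h]

lemma restrict_congr_of_withDensity_eq {α : Type*} [MeasurableSpace α] {μ ν : Measure α}
    {f : α → ℝ≥0∞} (hf : Measurable f) (hf_top : ∀ x, f x ≠ ⊤)
    (h : μ.withDensity f = ν.withDensity f) :
    μ.restrict {x | f x ≠ 0} = ν.restrict {x | f x ≠ 0} := by
  have hs : MeasurableSet {x | f x ≠ 0} := hf (measurableSet_singleton 0).compl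
  have hinv (ρ : Measure α) : ((ρ.withDensity f).restrict {x | f x ≠ 0}).withDensity f⁻¹
      = ρ.restrict {x | f x ≠ 0} := by
    rw [restrict_withDensity hs]
    exact withDensity_inv_same hf (ae_restrict_mem hs) (ae_of_all _ hf_top)
  rw [← hinv μ, ← hinv ν, h]

theorem restrict_compl_zero_congr_of_marginal [CompleteSpace E] [SecondCountableTopology E]
    (hμ : ∀ ξ, IntegrableOn (taylorGauge m) (Iio 0) (marginal μ ξ))
    (h : ∀ ξ, (marginal μ ξ).restrict (Iio 0) = (marginal ν ξ).restrict (Iio 0)) :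
    μ.restrict {0}ᶜ = ν.restrict {0}ᶜ := by
  have hν (ξ : E) : IntegrableOn (taylorGauge m) (Iio 0) (marginal ν ξ) := by
    rw [IntegrableOn, ← h]
    exact hμ ξ
  let U (η : E) : Set E := {x | ENNReal.ofReal (expWeight (m + 1) (inner ℝ x η)) ≠ 0}
  have hU (η : E) : μ.restrict (U η) = ν.restrict (U η) :=
    restrict_congr_of_withDensity_eq (measurable_expWeight_inner _ η)
      (fun _ ↦ ENNReal.ofReal_ne_top)
      (weighted_congr (integrable_taylorGauge_marginal hμ) (integrable_taylorGauge_marginal hν)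
        (marginal_restrict_compl_zero_congr h) η)
  have hU_nhds : ∀ y ∈ ({0}ᶜ : Set E), U ((‖y‖ ^ 2)⁻¹ • y) ∈ 𝓝[{0}ᶜ] y := by
    intro y hy
    have hopen : IsOpen (U ((‖y‖ ^ 2)⁻¹ • y)) := isOpen_ne_fun
      (ENNReal.continuous_ofReal.comp ((continuous_expWeight _).comp (by fun_prop)))
      continuous_const
    have hinner : inner ℝ y ((‖y‖ ^ 2)⁻¹ • y) = 1 := by
      rw [real_inner_smul_right, real_inner_self_eq_norm_sq]
      exact inv_mul_cancel₀ (pow_ne_zero 2 (norm_ne_zero_iff.2 hy))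
    refine mem_nhdsWithin_of_mem_nhds (hopen.mem_nhds ?_)
    simpa only [U, mem_ofPred_eq, hinner, ne_eq, ENNReal.ofReal_eq_zero, not_le]
      using expWeight_one_pos (m + 1)
  obtain ⟨t, -, ht_countable, ht_cover⟩ := TopologicalSpace.countable_cover_nhdsWithin hU_nhds
  exact Measure.restrict_congr_mono ht_cover
    ((Measure.restrict_biUnion_congr ht_countable).2 fun y _ ↦ hU _)

end Marginals

section Halfspaces

variable {d : ℕ} {μ ν : Measure (Punctured d)} {a : UnitSphere d → ℝ → ℝ} {β γ : ℝ}

instance : IsFiniteMeasure (sphereMeasure d) := by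
  unfold sphereMeasure
  rcases eq_or_ne ((volume : Measure (Space d)).toSphere univ) 0 with h | h
  · rw [Measure.measure_univ_eq_zero.1 h, smul_zero]
    infer_instance
  · exact Measure.smul_finite _ (ENNReal.inv_ne_top.2 h)

instance : (sphereMeasure d).IsOpenPosMeasure := by
  unfold sphereMeasure
  exact Measure.isOpenPosMeasure_smul _ (ENNReal.inv_ne_zero.2 (measure_ne_top _ _))

lemma measurableSet_halfspace (ω : UnitSphere d) (p : ℝ) : MeasurableSet (halfspace ω p) :=
  measurableSet_lt (by fun_prop) measurable_const

lemma neg_inner_le_norm (x : Space d) (ω : UnitSphere d) : -inner ℝ x (ω : Space d) ≤ ‖x‖ := by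
  have h := abs_real_inner_le_norm x (ω : Space d)
  rw [norm_eq_of_mem_sphere, mul_one] at h
  exact (neg_le_abs _).trans h

lemma neg_lt_norm_of_inner_lt {ω : UnitSphere d} {p : ℝ} {x : Space d}
    (hx : inner ℝ x (ω : Space d) < p) : -p < ‖x‖ :=
  (neg_lt_neg hx).trans_le (neg_inner_le_norm x ω)

/-- The measure `μ` has finite mass outside every ball around the origin. -/
def FiniteAway (μ : Measure (Punctured d)) : Prop :=
  ∀ r : ℝ, 0 < r → μ {x | r ≤ ‖(x : Space d)‖} < ⊤

lemma Represents.finiteAway (h : Represents μ a) : FiniteAway μ := by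
  refine fun r hr ↦ h.finite_away _ fun h₀ ↦ ?_
  have hclosed : IsClosed {x : Space d | r ≤ ‖x‖} := isClosed_le continuous_const continuous_norm
  have hmem : (0 : Space d) ∈ {x | r ≤ ‖x‖} :=
    closure_minimal (by rintro _ ⟨x, hx, rfl⟩; exact hx) hclosed h₀
  rw [mem_ofPred_eq, norm_zero] at hmem
  exact hr.not_ge hmem

lemma FiniteAway.sigmaFinite (h : FiniteAway μ) : SigmaFinite μ := by
  refine ⟨⟨⟨fun n ↦ {x | 1 / (n + 1 : ℝ) ≤ ‖(x : Space d)‖}, fun _ ↦ mem_univ _,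
    fun n ↦ h _ (by positivity), eq_univ_of_forall fun x ↦ ?_⟩⟩⟩
  obtain ⟨n, hn⟩ := exists_nat_one_div_lt (norm_pos_iff.2 x.2)
  exact mem_iUnion.2 ⟨n, hn.le⟩

lemma FiniteAway.halfspace_lt_top (h : FiniteAway μ) (ω : UnitSphere d) {p : ℝ} (hp : p < 0) :
    μ (halfspace ω p) < ⊤ :=
  (measure_mono fun _ hx ↦ (neg_lt_norm_of_inner_lt hx).le).trans_lt (h (-p) (neg_pos.2 hp))

lemma frequently_nhdsLT_of_ae {α : Type*} [TopologicalSpace α] [LinearOrder α] [OrderTopology α]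
    [DenselyOrdered α] [NoMinOrder α] [MeasurableSpace α] {ρ : Measure α} [ρ.IsOpenPosMeasure]
    {P : α → Prop} (h : ∀ᵐ q ∂ρ, P q) (p : α) : ∃ᶠ q in 𝓝[<] p, P q := by
  have hp : p ∈ closure (Iio p ∩ {q | P q}) :=
    closure_minimal ((Measure.dense_of_ae h).open_subset_closure_inter isOpen_Iio) isClosed_closure
      (by rw [closure_Iio]; exact self_mem_Iic)
  exact frequently_nhdsWithin_iff.2
    ((mem_closure_iff_frequently.1 hp).mono fun _ hq ↦ ⟨hq.2, hq.1⟩)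

lemma tendsto_measure_halfspace_nhdsLT (μ : Measure (Punctured d)) (ω : UnitSphere d) (p : ℝ) :
    Tendsto (fun q ↦ μ (halfspace ω q)) (𝓝[<] p) (𝓝 (μ (halfspace ω p))) := by
  have hunion : ⋃ q : Iio p, halfspace ω q = halfspace ω p := by
    ext x
    simp only [halfspace, mem_iUnion, mem_ofPred_eq, Subtype.exists, mem_Iio, exists_prop]
    exact ⟨fun ⟨q, hqp, hxq⟩ ↦ hxq.trans hqp,
      fun hx ↦ (exists_between hx).imp fun q hq ↦ ⟨hq.2, hq.1⟩⟩
  have hmono : Monotone (halfspace ω) := fun _ _ hqr _ hx ↦ lt_of_lt_of_le hx hqr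
  rw [← tendsto_comp_coe_Iio_atTop, ← hunion]
  exact tendsto_measure_iUnion_atTop (hmono.comp (Subtype.mono_coe _))

lemma FiniteAway.continuousAt_measure_halfspace (h : FiniteAway μ) {ω : UnitSphere d} {p : ℝ}
    (hp : p < 0) (hlevel : μ {x | inner ℝ (x : Space d) (ω : Space d) = p} = 0) :
    ContinuousAt (fun ω' ↦ μ (halfspace ω' p)) ω := by
  refine tendsto_measure_of_ae_tendsto_indicator (𝓝 ω) (measurableSet_halfspace ω p)
    (fun ω' ↦ measurableSet_halfspace ω' p) (B := {x : Punctured d | -p ≤ ‖(x : Space d)‖})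
    (measurableSet_le measurable_const (by fun_prop)) (h (-p) (neg_pos.2 hp)).ne
    (Eventually.of_forall fun ω' x hx ↦ (neg_lt_norm_of_inner_lt hx).le) ?_
  filter_upwards [measure_eq_zero_iff_ae_notMem.1 hlevel] with x hx
  have hcont : ContinuousAt (fun ω' : UnitSphere d ↦ inner ℝ (x : Space d) (ω' : Space d)) ω := by
    fun_prop
  rcases lt_or_gt_of_ne hx with hlt | hgt
  · filter_upwards [hcont.eventually_lt_const hlt] with ω' hω'
    exact iff_of_true hω' hlt
  · filter_upwards [hcont.eventually_const_lt hgt] with ω' hω'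
    exact iff_of_false hω'.not_gt hgt.not_gt

lemma ae_level_null (μ : Measure (Punctured d)) [SFinite μ] (ω : UnitSphere d) :
    ∀ᵐ p, μ {x | inner ℝ (x : Space d) (ω : Space d) = p} = 0 := by
  have hcount := Measure.countable_meas_level_set_pos (μ := μ)
    (g := fun x : Punctured d ↦ inner ℝ (x : Space d) (ω : Space d)) (by fun_prop)
  filter_upwards [hcount.ae_notMem volume] with p hp
  exact not_lt.1 hp |>.antisymm zero_le

lemma measure_halfspace_congr_of_dense (hμ : FiniteAway μ) (hν : FiniteAway ν)
    {D : Set (UnitSphere d)} (hD : Dense D)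
    (h : ∀ ω ∈ D, ∀ p < 0, μ (halfspace ω p) = ν (halfspace ω p))
    (ω : UnitSphere d) {p : ℝ} (hp : p < 0) : μ (halfspace ω p) = ν (halfspace ω p) := by
  have := hμ.sigmaFinite
  have := hν.sigmaFinite
  refine tendsto_nhds_unique_of_frequently_eq (tendsto_measure_halfspace_nhdsLT μ ω p)
    (tendsto_measure_halfspace_nhdsLT ν ω p) ?_
  have hnull := frequently_nhdsLT_of_ae ((ae_level_null μ ω).and (ae_level_null ν ω)) p
  refine (hnull.and_eventually eventually_mem_nhdsWithin).mono fun q ⟨⟨hμq, hνq⟩, hqp⟩ ↦ ?_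
  have hq : q < 0 := lt_trans hqp hp
  exact tendsto_nhds_unique_of_frequently_eq (hμ.continuousAt_measure_halfspace hq hμq)
    (hν.continuousAt_measure_halfspace hq hνq)
    ((mem_closure_iff_frequently.1 (hD ω)).mono fun ω' hω' ↦ h ω' hω' q hq)

lemma HomogeneousInP.eq_mul (ha : HomogeneousInP a γ) (ω : UnitSphere d) {p : ℝ} (hp : p < 0) :
    a ω p = a ω (-1) * (-p) ^ γ := by
  rw [mul_comm, ← ha ω (-1) (-p) neg_one_lt_zero (neg_pos.2 hp), mul_neg_one, neg_neg]

lemma HomogeneousInP.continuousAt (ha : HomogeneousInP a γ) (ω : UnitSphere d) {p : ℝ}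
    (hp : p < 0) : ContinuousAt (a ω) p := by
  have hpow : ContinuousAt (fun q ↦ a ω (-1) * (-q) ^ γ) p :=
    continuousAt_const.mul (continuousAt_neg.rpow_const (Or.inl (neg_ne_zero.2 hp.ne)))
  refine hpow.congr ?_
  filter_upwards [Iio_mem_nhds hp] with q hq
  exact (ha.eq_mul ω hq).symm

lemma Represents.ae_forall_halfspace (h : Represents μ a) (ha : HomogeneousInP a γ) :
    ∀ᵐ ω ∂(sphereMeasure d), ∀ p < 0, μ.real (halfspace ω p) = a ω p := by
  filter_upwards [Measure.ae_ae_of_ae_prod h.halfspace_eq] with ω hω p hp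
  rw [ae_restrict_iff' measurableSet_Iio] at hω
  refine tendsto_nhds_unique_of_frequently_eq
    ((ENNReal.tendsto_toReal (h.finiteAway.halfspace_lt_top ω hp).ne).comp
      (tendsto_measure_halfspace_nhdsLT μ ω p))
    ((ha.continuousAt ω hp).tendsto.mono_left nhdsWithin_le_nhds) ?_
  exact ((frequently_nhdsLT_of_ae hω p).and_eventually eventually_mem_nhdsWithin).mono
    fun q ⟨hq, hqp⟩ ↦ hq (lt_trans hqp hp)

lemma Represents.measure_halfspace_congr (hμ : Represents μ a) (hν : Represents ν a)
    (ha : HomogeneousInP a γ) (ω : UnitSphere d) {p : ℝ} (hp : p < 0) :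
    μ (halfspace ω p) = ν (halfspace ω p) := by
  refine measure_halfspace_congr_of_dense hμ.finiteAway hν.finiteAway
    (Measure.dense_of_ae (μ := sphereMeasure d) ?_) (fun ω hω ↦ hω) ω hp
  filter_upwards [hμ.ae_forall_halfspace ha, hν.ae_forall_halfspace ha] with ω hωμ hων p hp
  rw [← ENNReal.toReal_eq_toReal_iff' (hμ.finiteAway.halfspace_lt_top ω hp).ne
    (hν.finiteAway.halfspace_lt_top ω hp).ne]
  exact (hωμ p hp).trans (hων p hp).symm

/-- The dilation `x ↦ s • x` of the punctured space. -/
def dilation (s : ℝ) (hs : s ≠ 0) (x : Punctured d) : Punctured d :=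
  ⟨s • (x : Space d), smul_ne_zero hs x.2⟩

lemma continuous_dilation (s : ℝ) (hs : s ≠ 0) : Continuous (dilation (d := d) s hs) := by
  unfold dilation; fun_prop

/-- The image of `μ` under `x ↦ s • x`, normalized by `s ^ (-β)` so that the masses of halfspaces
do not change when they are homogeneous of degree `-β`. -/
def rescale (μ : Measure (Punctured d)) (β s : ℝ) (hs : 0 < s) : Measure (Punctured d) :=
  ENNReal.ofReal (s ^ (-β)) • μ.map (dilation s hs.ne')

lemma rescale_apply (μ : Measure (Punctured d)) (β s : ℝ) (hs : 0 < s) {A : Set (Punctured d)}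
    (hA : MeasurableSet A) :
    rescale μ β s hs A = ENNReal.ofReal (s ^ (-β)) * μ (dilation s hs.ne' ⁻¹' A) := by
  rw [rescale, Measure.smul_apply, smul_eq_mul,
    Measure.map_apply (continuous_dilation s hs.ne').measurable hA]

lemma rescale_halfspace (μ : Measure (Punctured d)) (β s : ℝ) (hs : 0 < s) (ω : UnitSphere d)
    (p : ℝ) : rescale μ β s hs (halfspace ω p)
      = ENNReal.ofReal (s ^ (-β)) * μ (halfspace ω (s⁻¹ * p)) := by
  rw [rescale_apply μ β s hs (measurableSet_halfspace ω p)]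
  congr 2
  ext x
  simp only [dilation, halfspace, mem_preimage, mem_ofPred_eq, real_inner_smul_left]
  exact (lt_inv_mul_iff₀ hs).symm

lemma FiniteAway.rescale (h : FiniteAway μ) (β s : ℝ) (hs : 0 < s) :
    FiniteAway (rescale μ β s hs) := by
  intro r hr
  rw [rescale_apply μ β s hs (measurableSet_le measurable_const (by fun_prop))]
  refine ENNReal.mul_lt_top ENNReal.ofReal_lt_top
    ((measure_mono fun x hx ↦ ?_).trans_lt (h (s⁻¹ * r) (by positivity)))
  simp only [dilation, mem_preimage, mem_ofPred_eq, norm_smul, Real.norm_of_nonneg hs.le] at hx ⊢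
  exact (inv_mul_le_iff₀ hs).2 hx

lemma Represents.measure_rescale_halfspace (h : Represents μ a) (ha : HomogeneousInP a (-β))
    {s : ℝ} (hs : 0 < s) (ω : UnitSphere d) {p : ℝ} (hp : p < 0) :
    CramerWold.rescale μ β s hs (halfspace ω p) = μ (halfspace ω p) := by
  refine measure_halfspace_congr_of_dense (h.finiteAway.rescale β s hs) h.finiteAway
    (Measure.dense_of_ae (μ := sphereMeasure d) ?_) (fun ω hω ↦ hω) ω hp
  filter_upwards [h.ae_forall_halfspace ha] with ω hω p hp
  have hp' : s⁻¹ * p < 0 := mul_neg_of_pos_of_neg (inv_pos.2 hs) hp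
  rw [rescale_halfspace, ← ofReal_measureReal (h.finiteAway.halfspace_lt_top ω hp).ne,
    ← ofReal_measureReal (h.finiteAway.halfspace_lt_top ω hp').ne, hω _ hp', hω _ hp,
    ← ENNReal.ofReal_mul (by positivity), ha _ _ _ hp (inv_pos.2 hs), ← mul_assoc,
    Real.inv_rpow hs.le, mul_inv_cancel₀ (by positivity), one_mul]

end Halfspaces

section Uniqueness

variable {E : Type*} [NormedAddCommGroup E] [InnerProductSpace ℝ E] [MeasurableSpace E]
  [BorelSpace E]

lemma marginal_smul_Iio (μ : Measure E) {r : ℝ} (hr : 0 < r) (ξ : E) (p : ℝ) :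
    marginal μ (r • ξ) (Iio p) = marginal μ ξ (Iio (p / r)) := by
  rw [marginal, marginal, Measure.map_apply (by fun_prop) measurableSet_Iio,
    Measure.map_apply (by fun_prop) measurableSet_Iio]
  congr 1
  ext x
  simp only [mem_preimage, mem_Iio, real_inner_smul_right, lt_div_iff₀' hr]

lemma marginal_zero_restrict_Iio (μ : Measure E) : (marginal μ 0).restrict (Iio 0) = 0 := by
  rw [Measure.restrict_eq_zero, marginal, Measure.map_apply (by fun_prop) measurableSet_Iio]
  simp

variable {d : ℕ} {μ ν : Measure (Punctured d)} {a : UnitSphere d → ℝ → ℝ} {β : ℝ}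

lemma marginal_map_coe_Iio (μ : Measure (Punctured d)) (ω : UnitSphere d) (p : ℝ) :
    marginal (μ.map Subtype.val) (ω : Space d) (Iio p) = μ (halfspace ω p) := by
  rw [marginal, Measure.map_map (by fun_prop) measurable_subtype_coe,
    Measure.map_apply (by fun_prop) measurableSet_Iio]
  rfl

lemma exists_marginal_map_coe_Iio {ξ : Space d} (hξ : ξ ≠ 0) :
    ∃ (ω : UnitSphere d) (r : ℝ), 0 < r ∧ ∀ (μ : Measure (Punctured d)) (p : ℝ),
      marginal (μ.map Subtype.val) ξ (Iio p) = μ (halfspace ω (p / r)) := by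
  have hr : 0 < ‖ξ‖ := norm_pos_iff.2 hξ
  refine ⟨⟨‖ξ‖⁻¹ • ξ, by simp [norm_smul, hr.ne']⟩, ‖ξ‖, hr, fun μ p ↦ ?_⟩
  rw [← marginal_map_coe_Iio, ← marginal_smul_Iio _ hr, smul_inv_smul₀ hr.ne']

/-- The masses of the halfspaces are finite and homogeneous of degree `-β` in `p`, in every
direction. -/
structure HomogeneousTails (μ : Measure (Punctured d)) (β : ℝ) : Prop where
  lt_top (ω : UnitSphere d) : μ (halfspace ω (-1)) < ⊤
  eq_mul (ω : UnitSphere d) {p : ℝ} (hp : p < 0) :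
    μ (halfspace ω p) = μ (halfspace ω (-1)) * ENNReal.ofReal ((-p) ^ (-β))

lemma Represents.homogeneousTails (h : Represents μ a) (ha : HomogeneousInP a (-β)) :
    HomogeneousTails μ β where
  lt_top ω := h.finiteAway.halfspace_lt_top ω neg_one_lt_zero
  eq_mul ω p hp := by
    rw [← h.measure_rescale_halfspace ha (neg_pos.2 hp) ω hp, rescale_halfspace, mul_comm, inv_neg,
      neg_mul, inv_mul_cancel₀ hp.ne]

lemma HomogeneousTails.exists_marginal_restrict_Iio (h : HomogeneousTails μ β) (hβ : 0 < β)
    (ξ : Space d) :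
    ∃ c : ℝ≥0∞, c ≠ ⊤ ∧ (marginal (μ.map Subtype.val) ξ).restrict (Iio 0) = c • powerTail β := by
  rcases eq_or_ne ξ 0 with rfl | hξ
  · exact ⟨0, ENNReal.zero_ne_top, by rw [marginal_zero_restrict_Iio, zero_smul]⟩
  · obtain ⟨ω, r, hr, hξω⟩ := exists_marginal_map_coe_Iio hξ
    have hc : μ (halfspace ω (-1)) * ENNReal.ofReal (r ^ β) ≠ ⊤ :=
      ENNReal.mul_ne_top (h.lt_top ω).ne ENNReal.ofReal_ne_top
    refine ⟨_, hc, restrict_Iio_eq_smul_powerTail hβ hc fun p hp ↦ ?_⟩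
    rw [hξω, h.eq_mul ω (div_neg_of_neg_of_pos hp hr), mul_assoc,
      ← ENNReal.ofReal_mul (by positivity), ← neg_div,
      Real.div_rpow (neg_pos.2 hp).le hr.le, Real.rpow_neg hr.le, div_inv_eq_mul, mul_comm (r ^ β)]

lemma HomogeneousTails.marginal_restrict_Iio_congr (hμ : HomogeneousTails μ β)
    (h : ∀ ω, ∀ p < 0, μ (halfspace ω p) = ν (halfspace ω p)) (ξ : Space d) :
    (marginal (μ.map Subtype.val) ξ).restrict (Iio 0)
      = (marginal (ν.map Subtype.val) ξ).restrict (Iio 0) := by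
  rcases eq_or_ne ξ 0 with rfl | hξ
  · rw [marginal_zero_restrict_Iio, marginal_zero_restrict_Iio]
  · obtain ⟨ω, r, hr, hξω⟩ := exists_marginal_map_coe_Iio hξ
    refine restrict_Iio_congr (fun p hp ↦ ?_) fun p hp ↦ ?_
    · rw [hξω, hμ.eq_mul ω (div_neg_of_neg_of_pos hp hr)]
      exact ENNReal.mul_ne_top (hμ.lt_top ω).ne ENNReal.ofReal_ne_top
    · rw [hξω, hξω, h ω _ (div_neg_of_neg_of_pos hp hr)]

theorem HomogeneousTails.measure_eq (hβ : 0 < β) (hβ_int : ∀ n : ℤ, β ≠ n)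
    (hμ : HomogeneousTails μ β) (h : ∀ ω, ∀ p < 0, μ (halfspace ω p) = ν (halfspace ω p)) :
    μ = ν := by
  have hfloor : (⌊β⌋₊ : ℝ) < β :=
    lt_of_le_of_ne (Nat.floor_le hβ.le) fun h ↦ hβ_int ⌊β⌋₊ (by rw [Int.cast_natCast, h])
  have hint (ξ : Space d) :
      IntegrableOn (taylorGauge ⌊β⌋₊) (Iio 0) (marginal (μ.map Subtype.val) ξ) := by
    obtain ⟨c, hc, hξ⟩ := hμ.exists_marginal_restrict_Iio hβ ξ
    rw [IntegrableOn, hξ]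
    exact (integrable_taylorGauge_powerTail hfloor (Nat.lt_floor_add_one β)).smul_measure hc
  have hzero (ρ : Measure (Punctured d)) :
      (ρ.map Subtype.val).restrict {(0 : Space d)}ᶜ = ρ.map Subtype.val := by
    have hpre : (Subtype.val ⁻¹' {(0 : Space d)}ᶜ : Set (Punctured d)) = univ :=
      eq_univ_of_forall Subtype.prop
    rw [Measure.restrict_map measurable_subtype_coe (measurableSet_singleton 0).compl, hpre,
      Measure.restrict_univ]
  have hmap := restrict_compl_zero_congr_of_marginal hint (hμ.marginal_restrict_Iio_congr h)
  rw [hzero, hzero] at hmap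
  have hemb : MeasurableEmbedding (Subtype.val : Punctured d → Space d) :=
    .subtype_coe (measurableSet_singleton 0).compl
  exact hemb.map_injective hmap

lemma Represents.unique (hβ : 0 < β) (hβ_int : ∀ n : ℤ, β ≠ n) (ha : HomogeneousInP a (-β))
    (hμ : Represents μ a) (hν : Represents ν a) : μ = ν :=
  (hμ.homogeneousTails ha).measure_eq hβ hβ_int fun ω _ hp ↦ hμ.measure_halfspace_congr hν ha ω hp

lemma Represents.rescale_eq (hβ : 0 < β) (hβ_int : ∀ n : ℤ, β ≠ n) (ha : HomogeneousInP a (-β))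
    (h : Represents μ a) {s : ℝ} (hs : 0 < s) : rescale μ β s hs = μ :=
  ((h.homogeneousTails ha).measure_eq hβ hβ_int fun ω _ hp ↦
    (h.measure_rescale_halfspace ha hs ω hp).symm).symm

lemma Represents.homogeneousMeasure (hβ : 0 < β) (hβ_int : ∀ n : ℤ, β ≠ n)
    (ha : HomogeneousInP a (-β)) (h : Represents μ a) : HomogeneousMeasure μ (-d - β) := by
  intro φ hφ _ _ r hr
  have hr' : 0 < r⁻¹ := inv_pos.2 hr
  have hscale : ∫ x, φ x ∂μ = r ^ β * ∫ x : Punctured d, φ (r⁻¹ • (x : Space d)) ∂μ := by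
    nth_rewrite 1 [← h.rescale_eq hβ hβ_int ha hr']
    rw [rescale, integral_smul_measure, integral_map
      (continuous_dilation r⁻¹ hr'.ne').aemeasurable
      (f := fun x : Punctured d ↦ φ x)
      (hφ.continuous.comp continuous_subtype_val).aestronglyMeasurable,
      ENNReal.toReal_ofReal (by positivity), Real.inv_rpow hr.le, Real.rpow_neg hr.le, inv_inv]
    rfl
  rw [hscale, ← mul_assoc, ← Real.rpow_add hr, add_sub_assoc', add_neg_cancel, zero_sub,
    neg_add_cancel, Real.rpow_zero, one_mul]

end Uniqueness

section RadonTransform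

variable {d : ℕ} {μ : Measure (Punctured d)} {a : UnitSphere d → ℝ → ℝ} {β : ℝ}

/-- The Radon transform of `μ` as a measure on all of `S^{d-1} × ℝ`: the image of `dω dμ` under
`(ω, x) ↦ (ω, x · ω)`. -/
def radonMeasure (μ : Measure (Punctured d)) : Measure (UnitSphere d × ℝ) :=
  ((sphereMeasure d).prod μ).map fun z ↦ (z.1, inner ℝ (z.2 : Space d) (z.1 : Space d))

/-- The density of the Radon transform on `S^{d-1} × {p < 0}` of a measure whose halfspace masses
are homogeneous of degree `-β`. -/
def radonDensity (μ : Measure (Punctured d)) (β : ℝ) (z : UnitSphere d × ℝ) : ℝ≥0∞ :=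
  μ (halfspace z.1 (-1)) * ENNReal.ofReal (β * (-z.2) ^ (-β - 1))

lemma measurable_measure_halfspace (μ : Measure (Punctured d)) [SFinite μ] (p : ℝ) :
    Measurable fun ω ↦ μ (halfspace ω p) := by
  have hs : MeasurableSet {z : UnitSphere d × Punctured d |
      inner ℝ (z.2 : Space d) (z.1 : Space d) < p} :=
    measurableSet_lt (by fun_prop) measurable_const
  exact measurable_measure_prodMk_left hs

lemma measurable_radonDensity (μ : Measure (Punctured d)) [SFinite μ] (β : ℝ) :
    Measurable (radonDensity μ β) :=
  ((measurable_measure_halfspace μ (-1)).comp measurable_fst).mul (by fun_prop)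

lemma HomogeneousTails.radonDensity_lt_top (h : HomogeneousTails μ β) (z : UnitSphere d × ℝ) :
    radonDensity μ β z < ⊤ :=
  ENNReal.mul_lt_top (h.lt_top z.1) ENNReal.ofReal_lt_top

lemma radonMeasure_prod (μ : Measure (Punctured d)) [SFinite μ] {s : Set (UnitSphere d)}
    {t : Set ℝ} (hs : MeasurableSet s) (ht : MeasurableSet t) :
    radonMeasure μ (s ×ˢ t)
      = ∫⁻ ω in s, marginal (μ.map Subtype.val) (ω : Space d) t ∂(sphereMeasure d) := by
  have hmeas : Measurable fun z : UnitSphere d × Punctured d ↦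
      (z.1, inner ℝ (z.2 : Space d) (z.1 : Space d)) := by fun_prop
  rw [radonMeasure, Measure.map_apply hmeas (hs.prod ht),
    Measure.prod_apply (hmeas (hs.prod ht)), ← lintegral_indicator hs]
  refine lintegral_congr fun ω ↦ ?_
  by_cases hω : ω ∈ s
  · rw [indicator_of_mem hω, marginal, Measure.map_map (by fun_prop) measurable_subtype_coe,
      Measure.map_apply (by fun_prop) ht]
    congr 1
    ext x
    simp [hω]
  · have hempty : Prod.mk ω ⁻¹' ((fun z : UnitSphere d × Punctured d ↦
        (z.1, inner ℝ (z.2 : Space d) (z.1 : Space d))) ⁻¹' s ×ˢ t) = ∅ :=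
      eq_empty_of_forall_notMem fun _ hx ↦ hω hx.1
    rw [hempty, measure_empty, indicator_of_notMem hω]

lemma HomogeneousTails.radonMeasure_restrict_eq_prod [SFinite μ] (hβ : 0 < β)
    (h : HomogeneousTails μ β) :
    (radonMeasure μ).restrict (univ ×ˢ Iio 0)
      = ((sphereMeasure d).withDensity fun ω ↦ μ (halfspace ω (-1))).prod (powerTail β) := by
  have hc : Measurable fun ω ↦ μ (halfspace ω (-1)) := measurable_measure_halfspace μ (-1)
  have hfin := SigmaFinite.withDensity_of_ne_top (μ := sphereMeasure d)
    (ae_of_all _ fun ω ↦ (h.lt_top ω).ne)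
  refine (Measure.prod_eq fun s t hs ht ↦ ?_).symm
  rw [Measure.restrict_apply (hs.prod ht), prod_inter_prod, inter_univ,
    radonMeasure_prod μ hs (ht.inter measurableSet_Iio), withDensity_apply _ hs,
    ← lintegral_mul_const _ hc]
  refine lintegral_congr fun ω ↦ ?_
  rw [← Measure.restrict_apply ht,
    restrict_Iio_eq_smul_powerTail hβ (h.lt_top ω).ne fun p hp ↦ by
      rw [marginal_map_coe_Iio, h.eq_mul ω hp],
    Measure.smul_apply, smul_eq_mul]

theorem HomogeneousTails.radonMeasure_restrict [SFinite μ] (hβ : 0 < β)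
    (h : HomogeneousTails μ β) :
    (radonMeasure μ).restrict (univ ×ˢ Iio 0) = (negMeasure d).withDensity (radonDensity μ β) := by
  rw [h.radonMeasure_restrict_eq_prod hβ, powerTail,
    prod_withDensity (measurable_measure_halfspace μ (-1)) (by fun_prop)]
  rfl

lemma HomogeneousInP.hasDerivAt (ha : HomogeneousInP a (-β)) (ω : UnitSphere d) {p : ℝ}
    (hp : p < 0) : HasDerivAt (a ω) (a ω (-1) * (β * (-p) ^ (-β - 1))) p := by
  have hpow : HasDerivAt (fun q : ℝ ↦ a ω (-1) * (-q) ^ (-β))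
      (a ω (-1) * (-1 * -β * (-p) ^ (-β - 1))) p :=
    ((hasDerivAt_neg p).rpow_const (Or.inl (neg_ne_zero.2 hp.ne))).const_mul _
  rw [neg_mul_neg, one_mul] at hpow
  refine hpow.congr_of_eventuallyEq ?_
  filter_upwards [Iio_mem_nhds hp] with q hq
  exact ha.eq_mul ω hq

lemma Represents.ae_deriv_eq (h : Represents μ a) (hβ : 0 < β) (ha : HomogeneousInP a (-β)) :
    ∀ᵐ z ∂(negMeasure d), deriv (a z.1) z.2 = (radonDensity μ β z).toReal := by
  have hdir := (Measure.quasiMeasurePreserving_fst (μ := sphereMeasure d)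
    (ν := volume.restrict (Iio (0 : ℝ)))).ae (h.ae_forall_halfspace ha)
  have hneg := (Measure.quasiMeasurePreserving_snd (μ := sphereMeasure d)
    (ν := volume.restrict (Iio (0 : ℝ)))).ae (ae_restrict_mem measurableSet_Iio)
  filter_upwards [hdir, hneg] with ⟨ω, p⟩ hω hp
  have hpow : 0 ≤ (-p) ^ (-β - 1) := Real.rpow_nonneg (neg_pos.2 hp).le _
  rw [(ha.hasDerivAt ω hp).deriv, ← hω (-1) neg_one_lt_zero, radonDensity, ENNReal.toReal_mul,
    ENNReal.toReal_ofReal (mul_nonneg hβ.le hpow), measureReal_def]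

lemma extendZero_of_neg (ψ : NegTest d) (ω : UnitSphere d) {p : ℝ} (hp : p < 0) :
    extendZero ψ ω p = ψ (ω, ⟨p, hp⟩) := dif_pos hp

lemma extendZero_of_not_neg (ψ : NegTest d) (ω : UnitSphere d) {p : ℝ} (hp : ¬ p < 0) :
    extendZero ψ ω p = 0 := dif_neg hp

lemma measurable_extendZero (ψ : NegTest d) :
    Measurable fun z : UnitSphere d × ℝ ↦ extendZero ψ z.1 z.2 := by
  have hs : MeasurableSet {z : UnitSphere d × ℝ | z.2 < 0} :=
    measurableSet_lt measurable_snd measurable_const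
  have hf : Measurable fun z : {z : UnitSphere d × ℝ | z.2 < 0} ↦ ψ (z.1.1, ⟨z.1.2, z.2⟩) :=
    (ψ.continuous.comp (by fun_prop)).measurable
  exact hf.dite (g := fun _ ↦ 0) measurable_const hs

lemma exists_norm_extendZero_le (ψ : NegTest d) : ∃ M, ∀ ω p, ‖extendZero ψ ω p‖ ≤ M := by
  obtain ⟨M, hM⟩ := ψ.hasCompactSupport.exists_bound_of_continuous ψ.continuous
  refine ⟨max M 0, fun ω p ↦ ?_⟩
  by_cases hp : p < 0
  · exact extendZero_of_neg ψ ω hp ▸ (hM _).trans (le_max_left M 0)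
  · rw [extendZero_of_not_neg ψ ω hp, norm_zero]
    exact le_max_right M 0

lemma exists_le_neg_of_extendZero_ne_zero (ψ : NegTest d) :
    ∃ δ > 0, ∀ ω p, extendZero ψ ω p ≠ 0 → p ≤ -δ := by
  have hcont : Continuous fun z : UnitSphere d × Iio (0 : ℝ) ↦ -(z.2 : ℝ) := by fun_prop
  obtain ⟨δ, hδ, hle⟩ := ψ.hasCompactSupport.exists_forall_le' hcont.continuousOn
    fun z _ ↦ neg_pos.2 z.2.2
  refine ⟨δ, hδ, fun ω p hne ↦ ?_⟩
  have hp : p < 0 := not_not.1 (mt (extendZero_of_not_neg ψ ω) hne)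
  rw [extendZero_of_neg ψ ω hp] at hne
  exact le_neg.1 (hle (ω, ⟨p, hp⟩) (subset_tsupport _ hne))

lemma FiniteAway.radonMeasure_lt_top (h : FiniteAway μ) {δ : ℝ} (hδ : 0 < δ) :
    radonMeasure μ {z | z.2 ≤ -δ} < ⊤ := by
  have := h.sigmaFinite
  have hmono : (fun z : UnitSphere d × Punctured d ↦
      (z.1, inner ℝ (z.2 : Space d) (z.1 : Space d))) ⁻¹' {z | z.2 ≤ -δ}
        ⊆ univ ×ˢ {x : Punctured d | δ ≤ ‖(x : Space d)‖} := fun z hz ↦ by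
    have hle : inner ℝ (z.2 : Space d) (z.1 : Space d) ≤ -δ := hz
    exact ⟨mem_univ _, (le_neg.1 hle).trans (neg_inner_le_norm _ _)⟩
  rw [radonMeasure, Measure.map_apply (by fun_prop) (measurableSet_le (by fun_prop) (by fun_prop))]
  refine (measure_mono hmono).trans_lt ?_
  rw [Measure.prod_prod]
  exact ENNReal.mul_lt_top (measure_lt_top _ _) (h δ hδ)

lemma FiniteAway.integrable_extendZero (h : FiniteAway μ) (ψ : NegTest d) :
    Integrable (fun z ↦ extendZero ψ z.1 z.2) (radonMeasure μ) := by
  obtain ⟨M, hM⟩ := exists_norm_extendZero_le ψ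
  obtain ⟨δ, hδ, hsupp⟩ := exists_le_neg_of_extendZero_ne_zero ψ
  have hbdd : IntegrableOn (fun z ↦ extendZero ψ z.1 z.2) {z | z.2 ≤ -δ} (radonMeasure μ) :=
    IntegrableOn.of_bound (h.radonMeasure_lt_top hδ) (measurable_extendZero ψ).aestronglyMeasurable
      M (ae_of_all _ fun z ↦ hM z.1 z.2)
  refine (integrableOn_iff_integrable_of_support_subset ?_).1 hbdd
  exact fun (z : UnitSphere d × ℝ) hz ↦ hsupp z.1 z.2 hz

lemma FiniteAway.integrable_extendZero_inner (h : FiniteAway μ) (ψ : NegTest d) :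
    Integrable (fun z : UnitSphere d × Punctured d ↦
      extendZero ψ z.1 (inner ℝ (z.2 : Space d) (z.1 : Space d))) ((sphereMeasure d).prod μ) :=
  (h.integrable_extendZero ψ).comp_measurable (by fun_prop)

lemma FiniteAway.integrable_dualRadon (h : FiniteAway μ) (ψ : NegTest d) :
    Integrable (dualRadon ψ) μ := by
  have := h.sigmaFinite
  exact (h.integrable_extendZero_inner ψ).integral_prod_right

lemma FiniteAway.radonTransform_eq_integral (h : FiniteAway μ) (ψ : NegTest d) :
    radonTransform μ ψ = ∫ z, extendZero ψ z.1 z.2 ∂(radonMeasure μ) := by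
  have := h.sigmaFinite
  rw [radonMeasure, integral_map (by fun_prop) (measurable_extendZero ψ).aestronglyMeasurable,
    integral_prod_symm _ (h.integrable_extendZero_inner ψ)]
  rfl

lemma HomogeneousTails.integrable_radonDensity_mul (hβ : 0 < β) (hfin : FiniteAway μ)
    (h : HomogeneousTails μ β) (ψ : NegTest d) :
    Integrable (fun z ↦ (radonDensity μ β z).toReal * extendZero ψ z.1 z.2) (negMeasure d) := by
  have := hfin.sigmaFinite
  have hint := (hfin.integrable_extendZero ψ).restrict (s := univ ×ˢ Iio 0)
  rw [h.radonMeasure_restrict hβ] at hint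
  exact (integrable_withDensity_iff_integrable_smul' (measurable_radonDensity μ β)
    (ae_of_all _ h.radonDensity_lt_top)).1 hint

lemma HomogeneousTails.radonTransform_eq_integral (hβ : 0 < β) (hfin : FiniteAway μ)
    (h : HomogeneousTails μ β) (ψ : NegTest d) :
    radonTransform μ ψ
      = ∫ z, (radonDensity μ β z).toReal * extendZero ψ z.1 z.2 ∂(negMeasure d) := by
  have := hfin.sigmaFinite
  calc radonTransform μ ψ
      = ∫ z, extendZero ψ z.1 z.2 ∂(radonMeasure μ) := hfin.radonTransform_eq_integral ψ
    _ = ∫ z in univ ×ˢ Iio 0, extendZero ψ z.1 z.2 ∂(radonMeasure μ) :=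
        (setIntegral_eq_integral_of_forall_compl_eq_zero fun z hz ↦
          extendZero_of_not_neg ψ z.1 fun hneg ↦ hz (mk_mem_prod (mem_univ _) hneg)).symm
    _ = ∫ z, (radonDensity μ β z).toReal * extendZero ψ z.1 z.2 ∂(negMeasure d) := by
        rw [h.radonMeasure_restrict hβ,
          integral_withDensity_eq_integral_toReal_smul (measurable_radonDensity μ β)
            (ae_of_all _ h.radonDensity_lt_top)]
        rfl

lemma Represents.radonEqDerivP (hβ : 0 < β) (ha : HomogeneousInP a (-β)) (h : Represents μ a) :
    RadonEqDerivP μ a := by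
  have htails := h.homogeneousTails ha
  refine ⟨fun ω p hp ↦ (ha.hasDerivAt ω hp).differentiableAt, fun ψ ↦ ?_⟩
  have hderiv : (fun z ↦ (radonDensity μ β z).toReal * extendZero ψ z.1 z.2)
      =ᵐ[negMeasure d] fun z ↦ deriv (a z.1) z.2 * extendZero ψ z.1 z.2 := by
    filter_upwards [h.ae_deriv_eq hβ ha] with z hz
    rw [hz]
  exact ⟨h.finiteAway.integrable_dualRadon ψ,
    (htails.integrable_radonDensity_mul hβ h.finiteAway ψ).congr hderiv,
    (htails.radonTransform_eq_integral hβ h.finiteAway ψ).trans (integral_congr_ae hderiv)⟩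

end RadonTransform

end CramerWold

end

theorem mainTheorem4_general (d : ℕ) (β : ℝ) (hβ : 0 < β) (hβ_int : ∀ n : ℤ, β ≠ (n : ℝ))
    (a : UnitSphere d → ℝ → ℝ) (ha_hom : HomogeneousInP a (-β)) :
    (∀ μ ν : Measure (Punctured d), Represents μ a → Represents ν a → μ = ν) ∧
    (∀ μ : Measure (Punctured d), Represents μ a →
      HomogeneousMeasure μ (-(d : ℝ) - β) ∧ RadonEqDerivP μ a) :=
  ⟨fun _ _ hμ hν ↦ hμ.unique hβ hβ_int ha_hom hν,
    fun _ hμ ↦ ⟨hμ.homogeneousMeasure hβ hβ_int ha_hom, hμ.radonEqDerivP hβ ha_hom⟩⟩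

theorem mainTheorem4 (d : ℕ) (β : ℝ) (hβ : 0 < β) (hβ_int : ∀ n : ℤ, β ≠ (n : ℝ))
    (a : UnitSphere d → ℝ → ℝ) (ha_bdd : LocallyBoundedNeg a) (ha_hom : HomogeneousInP a (-β)) :
    (∀ μ ν : Measure (Punctured d), Represents μ a → Represents ν a → μ = ν) ∧
    (∀ μ : Measure (Punctured d), Represents μ a →
      HomogeneousMeasure μ (-(d : ℝ) - β) ∧ RadonEqDerivP μ a) :=
  mainTheorem4_general d β hβ hβ_int a ha_hom
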